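/- Let $[n]$ be a finite ground set and let $f:2^{[n]}\to\mathbb{R}_{\ge 0}$ be submodular, i.e. $f(S\cap T)+f(S\cup T)\le f(S)+f(T)$ for all $S,T\subseteq[n]$. Two sets are adjacent under token jumping, addition, or removal if either they have the same size and their intersection has size one less, or their symmetric difference has size $1$. For $X,Y\subseteq[n]$, a reconfiguration sequence from $X$ to $Y$ is a finite sequence of subsets of $[n]$ (of any length) that starts with $X$ and ends with $Y$ and in which consecutive sets are adjacent; its value is the minimum of $f$ over the sets in it. In the problem MaxUSReco[tjar], one is given $X$, $Y$ and a value oracle for $f$ (which returns $f(S)$ on a query $S$), and seeks a reconfiguration sequence from $X$ to $Y$ of maximum value, the optimal value. An algorithm is a $\rho$-approximation algorithm if on every instance it returns a reconfiguration sequence from $X$ to $Y$ whose value is at least $\rho$ times the optimal value (for a randomized algorithm: whose expected value is at least $\rho$ times the optimal value). **Theorem.** For every $\epsilon>0$ and for all sufficiently large $n$ (depending only on $\epsilon$), no algorithm, deterministic or randomized, adaptive and with no restriction on its running time, that makes at most $\mathrm{e}^{\epsilon^2 n/2}$ oracle calls on every instance with ground set $[n]$ (and, if randomized, for every outcome of its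 coins) is a $\left(\frac56+\epsilon\right)$-approximation algorithm for MaxUSReco[tjar] on the ground set $[n]$. -/

import Mathlib

open MeasureTheory Filter

noncomputable section

/-! ### Submodular functions and reconfiguration sequences -/

/-- A nonnegative submodular set function on the subsets of `α`. -/
structure IsNonnegSubmodular {α : Type} [DecidableEq α] (f : Finset α → ℝ) : Prop where
  nonneg : ∀ S, 0 ≤ f S
  submodular : ∀ S T, f (S ∩ T) + f (S ∪ T) ≤ f S + f T

/-- Adjacency under token jumping: the sets have the same size, and their intersection has size
one less. -/
def TJ {α : Type} [DecidableEq α] (S T : Finset α) : Prop :=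
  S.card = T.card ∧ (S ∩ T).card + 1 = S.card

/-- Adjacency under token addition or removal: the symmetric difference has size one. -/
def TAR {α : Type} [DecidableEq α] (S T : Finset α) : Prop :=
  (symmDiff S T).card = 1

/-- Adjacency under token jumping, addition, or removal, as a relation. -/
def tjar (α : Type) [DecidableEq α] : SetRel (Finset α) (Finset α) :=
  {p | TJ p.1 p.2 ∨ TAR p.1 p.2}

/-- Reconfiguration sequences from `X` to `Y` under token jumping, addition, or removal: finite
sequences `S⁰, …, Sˡ` (of any length `ℓ`) with `S⁰ = X`, `Sˡ = Y` and consecutive sets adjacent. -/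
def ReconfSeq {α : Type} [DecidableEq α] (X Y : Finset α) : Type :=
  {S : RelSeries (tjar α) // S.head = X ∧ S.last = Y}

/-- The value of a reconfiguration sequence: the minimum of `f` over the sets in it. -/
def ReconfSeq.value {α : Type} [DecidableEq α] {X Y : Finset α} (f : Finset α → ℝ)
    (S : ReconfSeq X Y) : ℝ :=
  Finset.univ.inf' ⟨0, Finset.mem_univ 0⟩ (fun i => f (S.1 i))

/-- The optimal value of the maximum reconfiguration problem: the largest value of a
reconfiguration sequence from `X` to `Y` (it is attained, see `optValue_isGreatest`). -/
def optValue {α : Type} [DecidableEq α] (f : Finset α → ℝ) (X Y : Finset α) : ℝ :=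
  sSup (Set.range (ReconfSeq.value f : ReconfSeq X Y → ℝ))

theorem TAR.insert_right {α : Type} [DecidableEq α] {a : α} {S : Finset α} (h : a ∉ S) :
    TAR S (insert a S) := by
  have : symmDiff S (insert a S) = {a} := by
    ext x
    simp only [Finset.mem_symmDiff, Finset.mem_insert, Finset.mem_singleton]
    by_cases hx : x = a
    · subst hx; simp [h]
    · simp [hx]
  rw [TAR, this, Finset.card_singleton]

instance ReconfSeq.instNonempty {α : Type} [DecidableEq α] (X Y : Finset α) :
    Nonempty (ReconfSeq X Y) := by
  induction X using Finset.induction_on with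
  | empty =>
    induction Y using Finset.induction_on with
    | empty => exact ⟨⟨RelSeries.singleton _ ∅, rfl, rfl⟩⟩
    | insert a S ha ih =>
      obtain ⟨p, h0, h1⟩ := ih
      have h : (p.last, insert a S) ∈ tjar α := by
        rw [h1]; exact Or.inr (TAR.insert_right ha)
      exact ⟨⟨p.snoc (insert a S) h, by rw [RelSeries.head_snoc, h0], by rw [RelSeries.last_snoc]⟩⟩
  | insert a S ha ih =>
    obtain ⟨p, h0, h1⟩ := ih
    have h : (insert a S, p.head) ∈ tjar α := by
      have h := TAR.insert_right ha
      rw [TAR, symmDiff_comm] at h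
      rw [h0]; exact Or.inr h
    exact ⟨⟨p.cons (insert a S) h, by rw [RelSeries.head_cons], by rw [RelSeries.last_cons, h1]⟩⟩

theorem optValue_isGreatest {α : Type} [DecidableEq α] [Finite α] (f : Finset α → ℝ)
    (X Y : Finset α) :
    IsGreatest (Set.range (ReconfSeq.value f : ReconfSeq X Y → ℝ)) (optValue f X Y) := by
  have hfin : (Set.range (ReconfSeq.value f : ReconfSeq X Y → ℝ)).Finite := by
    refine (Set.finite_range f).subset ?_
    rintro _ ⟨S, rfl⟩
    obtain ⟨i, -, hi⟩ := Finset.exists_mem_eq_inf' (s := Finset.univ)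
      ⟨(0 : Fin (S.1.length + 1)), Finset.mem_univ 0⟩ (fun i => f (S.1 i))
    exact ⟨S.1 i, hi.symm⟩
  have hne := Set.range_nonempty (ReconfSeq.value f : ReconfSeq X Y → ℝ)
  exact ⟨hne.csSup_mem hfin, fun _ hx => le_csSup hfin.bddAbove hx⟩

/-! ### Algorithms with a value oracle -/

/-- A deterministic adaptive computation with access to an oracle that answers queries in `Q` by
real numbers: it either stops with an output, or makes a query and continues in a way that may
depend arbitrarily on the answer. -/
inductive OracleComp (Q β : Type) : Type
  | output (b : β) : OracleComp Q β
  | query (q : Q) (next : ℝ → OracleComp Q β) : OracleComp Q β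

/-- The output of a computation when the oracle answers according to `f`. -/
def OracleComp.run {Q β : Type} (f : Q → ℝ) : OracleComp Q β → β
  | .output b => b
  | .query q next => (next (f q)).run f

/-- The number of oracle calls of a computation when the oracle answers according to `f`. -/
def OracleComp.calls {Q β : Type} (f : Q → ℝ) : OracleComp Q β → ℕ
  | .output _ => 0
  | .query q next => (next (f q)).calls f + 1

/-- A deterministic algorithm for the maximum reconfiguration problem on the ground set `Fin n`:
it gets `X` and `Y`, accesses the set function only through its value oracle, and returns a
reconfiguration sequence from `X` to `Y`. No bound is put on its running time. -/
def RecoAlgorithm (n : ℕ) : Type :=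
  ∀ X Y : Finset (Fin n), OracleComp (Finset (Fin n)) (ReconfSeq X Y)

/-- On every instance, the algorithm makes at most `q` oracle calls. -/
def RecoAlgorithm.MakesAtMost {n : ℕ} (A : RecoAlgorithm n) (q : ℝ) : Prop :=
  ∀ f : Finset (Fin n) → ℝ, IsNonnegSubmodular f → ∀ X Y, ((A X Y).calls f : ℝ) ≤ q

/-- On every instance, the algorithm returns a reconfiguration sequence whose value is at least
`ρ` times the optimal value. -/
def RecoAlgorithm.IsApprox {n : ℕ} (A : RecoAlgorithm n) (ρ : ℝ) : Prop :=
  ∀ f : Finset (Fin n) → ℝ, IsNonnegSubmodular f → ∀ X Y,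
    ρ * optValue f X Y ≤ ((A X Y).run f).value f

/-- A randomized algorithm is a family of deterministic algorithms indexed by the outcomes `ω` of
a probability space. It is a `ρ`-approximation in expectation if, on every instance, the value
of the returned sequence is integrable and its expectation is at least `ρ` times the optimal
value. -/
def IsApproxInExpectation {n : ℕ} {Ω : Type*} [MeasurableSpace Ω] (P : Measure Ω)
    (A : Ω → RecoAlgorithm n) (ρ : ℝ) : Prop :=
  ∀ f : Finset (Fin n) → ℝ, IsNonnegSubmodular f → ∀ X Y,
    Integrable (fun ω => ((A ω X Y).run f).value f) P ∧
      ρ * optValue f X Y ≤ ∫ ω, ((A ω X Y).run f).value f ∂P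

end

/-! Take disjoint pairs `P`, `Q`, let R be the rest of the ground set, m = n - 4 its size, and
colour R with uniformly random signs. Write k, p, q for the sizes of S ∩ R, S ∩ P, S ∩ Q. The hard
function is k(m - k) + d² + B(p + q - pq), where d is the distance of the sign sum of S ∩ R to [-δm,
δm] and B = (1/2 - δ)m². The concavity of k(m - k) pays for the convexity of d²
(`truncSq_second_difference`), so the function is submodular.

A set chosen without knowledge of the signs is nearly balanced by Hoeffding, so d = 0 and the oracle
answers as if there were no signs. Every sequence from `P` to `Q` meets a set with p = 1, whose
value without signs is at most m²/4 + B; a union bound over the queries and this one set gives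
`sum_value_run_hiddenFn_le`. Knowing the signs, one can first add a monochromatic set of at least
half of R and swap `P` for `Q` on top of it, never falling below 2B
(`two_mul_le_optValue_hiddenFn_boolSign`).

The ratio (3/4 - δ)/(1 - 2δ) lies below 5/6 + ε for δ = 5ε/4 and ε ≤ 1/6, and δ > ε lets the
Hoeffding bound beat exp(ε²n/2) queries. Averaging over the signs covers randomized algorithms. -/

noncomputable section

/-! ### A convex function with bounded second differences -/

/-- The squared distance of `x` to the interval `[-τ, τ]`. -/
def truncSq (τ x : ℝ) : ℝ :=
  (x - max (-τ) (min τ x)) ^ 2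

theorem truncSq_nonneg (τ x : ℝ) : 0 ≤ truncSq τ x :=
  sq_nonneg _

theorem truncSq_of_abs_le {τ x : ℝ} (h : |x| ≤ τ) : truncSq τ x = 0 := by
  obtain ⟨h1, h2⟩ := abs_le.1 h
  rw [truncSq, min_eq_right h2, max_eq_right h1, sub_self, zero_pow two_ne_zero]

theorem truncSq_of_le_abs {τ x : ℝ} (hτ : 0 ≤ τ) (h : τ ≤ |x|) :
    truncSq τ x = (|x| - τ) ^ 2 := by
  rcases abs_cases x with ⟨hx, h0⟩ | ⟨hx, h0⟩ <;> rw [hx] at h ⊢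
  · rw [truncSq, min_eq_left h, max_eq_right (by linarith)]
  · rw [truncSq, min_eq_right (by linarith), max_eq_left (by linarith)]
    ring

theorem truncSq_le {τ c : ℝ} (x : ℝ) (h1 : -τ ≤ c) (h2 : c ≤ τ) : truncSq τ x ≤ (x - c) ^ 2 := by
  rw [truncSq, sq_le_sq]
  rcases le_total τ x with h | h
  · rw [min_eq_left h, max_eq_right (by linarith), abs_of_nonneg (by linarith),
      abs_of_nonneg (by linarith)]
    linarith
  · rw [min_eq_right h]
    rcases le_total (-τ) x with h' | h'
    · rw [max_eq_right h', sub_self, abs_zero]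
      exact abs_nonneg _
    · rw [max_eq_left h', abs_of_nonpos (by linarith), abs_of_nonpos (by linarith)]
      linarith

/-- The mixed second differences of `truncSq τ` are at most those of `x ^ 2`, in absolute value. -/
theorem truncSq_second_difference {τ : ℝ} (hτ : 0 ≤ τ) (a u v : ℝ) :
    truncSq τ (a + u + v) + truncSq τ a ≤
      truncSq τ (a + u) + truncSq τ (a + v) + 2 * (|u| * |v|) := by
  -- `p` and `q` are the points of the interval nearest to `a + u` and `a + v`. Using them crosswise
  -- as centres for `a + u + v` and `a` in `truncSq_le` bounds the second difference by twice either
  -- left side in `key`.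
  obtain ⟨p, hp⟩ : ∃ p, p = max (-τ) (min τ (a + u)) := ⟨_, rfl⟩
  obtain ⟨q, hq⟩ : ∃ q, q = max (-τ) (min τ (a + v)) := ⟨_, rfl⟩
  have hp1 : -τ ≤ p := hp ▸ le_max_left _ _
  have hq1 : -τ ≤ q := hq ▸ le_max_left _ _
  have hp2 : p ≤ τ := hp ▸ max_le (by linarith) (min_le_left _ _)
  have hq2 : q ≤ τ := hq ▸ max_le (by linarith) (min_le_left _ _)
  have hpq : |p - q| ≤ |u - v| := by
    rw [hp, hq]
    refine (abs_max_sub_max_le_max _ _ _ _).trans ?_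
    rw [sub_self, abs_zero, max_eq_right (abs_nonneg _)]
    refine (abs_min_sub_min_le_max _ _ _ _).trans ?_
    rw [sub_self, abs_zero, max_eq_right (abs_nonneg _)]
    rw [add_sub_add_left_eq_sub]
  have e1 : truncSq τ (a + u) = (a + u - p) ^ 2 := by rw [truncSq, hp]
  have e2 : truncSq τ (a + v) = (a + v - q) ^ 2 := by rw [truncSq, hq]
  have i1 := truncSq_le (a + u + v) hp1 hp2
  have i2 := truncSq_le (a + u + v) hq1 hq2
  have i3 := truncSq_le a hp1 hp2
  have i4 := truncSq_le a hq1 hq2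
  -- If `u * v ≥ 0`, the two corrections cannot both be positive. If `u * v < 0`, failure of both
  -- would force `|p - q| > |u - v|`, but clamping is 1-Lipschitz.
  have key : u * v + v * (q - p) ≤ |u| * |v| ∨ u * v + u * (p - q) ≤ |u| * |v| := by
    rw [← abs_mul]
    by_contra! hcon
    obtain ⟨h1, h2⟩ := hcon
    rcases le_or_gt 0 (u * v) with h0 | h0
    · rw [abs_of_nonneg h0] at h1 h2
      have h1 : 0 < v * (q - p) := by linarith
      have h2 : 0 < u * (p - q) := by linarith
      nlinarith [mul_pos h1 h2, mul_nonneg h0 (sq_nonneg (p - q))]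
    · rw [abs_of_neg h0] at h1 h2
      have h1 : 0 < v * (2 * u + q - p) := by linarith
      have h2 : 0 < u * (2 * v + p - q) := by linarith
      rcases mul_neg_iff.1 h0 with ⟨hu, hv⟩ | ⟨hu, hv⟩
      · have h3 := neg_of_mul_pos_right h1 hv.le
        have h4 := pos_of_mul_pos_right h2 hu.le
        rw [abs_of_pos (by linarith : 0 < u - v)] at hpq
        linarith [le_abs_self (p - q)]
      · have h3 := pos_of_mul_pos_right h1 hv.le
        have h4 := neg_of_mul_pos_right h2 hu.le
        rw [abs_of_neg (by linarith : u - v < 0)] at hpq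
        linarith [neg_abs_le (p - q)]
  rw [e1, e2]
  rcases key with h | h
  · nlinarith
  · nlinarith

/-! ### Random signs -/

/-- The sign encoded by a Boolean. -/
def boolSign (b : Bool) : ℝ :=
  if b then 1 else -1

theorem abs_boolSign (b : Bool) : |boolSign b| = 1 := by
  cases b <;> simp [boolSign]

/-- The sum factors over coordinates; each one in `U` contributes `2 * cosh t`, and `cosh t ≤ exp (t
^ 2 / 2)`. -/
theorem sum_exp_sum_boolSign_le {α : Type} [Fintype α] [DecidableEq α] (U : Finset α) (t : ℝ) :
    ∑ σ : α → Bool, Real.exp (t * ∑ i ∈ U, boolSign (σ i)) ≤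
      2 ^ Fintype.card α * Real.exp (t ^ 2 * U.card / 2) := by
  have h1 : ∀ σ : α → Bool, Real.exp (t * ∑ i ∈ U, boolSign (σ i)) =
      ∏ i, if i ∈ U then Real.exp (t * boolSign (σ i)) else 1 := by
    intro σ
    rw [Finset.prod_ite_mem, Finset.univ_inter, Finset.mul_sum, Real.exp_sum]
  have h2 : ∑ σ : α → Bool, Real.exp (t * ∑ i ∈ U, boolSign (σ i)) =
      ∏ i, ∑ b : Bool, if i ∈ U then Real.exp (t * boolSign b) else 1 := by
    simp_rw [h1]
    rw [Finset.prod_univ_sum, Fintype.piFinset_univ]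
  have h3 : ∀ i, (∑ b : Bool, if i ∈ U then Real.exp (t * boolSign b) else 1) =
      2 * if i ∈ U then Real.cosh t else 1 := by
    intro i
    by_cases hi : i ∈ U
    · simp [hi, boolSign, Real.cosh_eq]; ring
    · simp [hi]
  rw [h2, Finset.prod_congr rfl fun i _ => h3 i, Finset.prod_mul_distrib, Finset.prod_const,
    Finset.card_univ, Finset.prod_ite_mem, Finset.univ_inter, Finset.prod_const]
  gcongr
  calc Real.cosh t ^ U.card ≤ Real.exp (t ^ 2 / 2) ^ U.card := by
        gcongr
        exact Real.cosh_le_exp_half_sq t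
    _ = Real.exp (t ^ 2 * U.card / 2) := by
        rw [← Real.exp_nat_mul]; congr 1; ring

/-- Hoeffding's inequality for the number of sign patterns with a large sum. -/
theorem card_filter_lt_abs_sum_boolSign_le {α : Type} [Fintype α] [DecidableEq α] (U : Finset α)
    {δ m : ℝ} (hδ : 0 ≤ δ) (hm : (U.card : ℝ) ≤ m) :
    (({σ : α → Bool | δ * m < |∑ i ∈ U, boolSign (σ i)|} : Finset (α → Bool)).card : ℝ) ≤
      2 ^ Fintype.card α * (2 * Real.exp (-(δ ^ 2 * m / 2))) := by
  have h : ∀ t : ℝ, t ^ 2 = δ ^ 2 → Real.exp (-(δ ^ 2 * m)) *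
      ∑ σ : α → Bool, Real.exp (t * ∑ i ∈ U, boolSign (σ i)) ≤
      2 ^ Fintype.card α * Real.exp (-(δ ^ 2 * m / 2)) := by
    intro t ht
    calc _ ≤ Real.exp (-(δ ^ 2 * m)) * (2 ^ Fintype.card α * Real.exp (t ^ 2 * U.card / 2)) := by
          gcongr; exact sum_exp_sum_boolSign_le U t
      _ ≤ Real.exp (-(δ ^ 2 * m)) * (2 ^ Fintype.card α * Real.exp (δ ^ 2 * m / 2)) := by
          rw [ht]; gcongr
      _ = 2 ^ Fintype.card α * Real.exp (-(δ ^ 2 * m / 2)) := by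
          rw [mul_left_comm, ← Real.exp_add]; congr 2; ring
  calc _ = ∑ σ : α → Bool, if δ * m < |∑ i ∈ U, boolSign (σ i)| then (1 : ℝ) else 0 := by
        rw [Finset.sum_boole]
    -- Chernoff bound with parameters `δ` and `-δ`, one for each tail.
    _ ≤ ∑ σ : α → Bool, (Real.exp (-(δ ^ 2 * m)) * Real.exp (δ * ∑ i ∈ U, boolSign (σ i)) +
          Real.exp (-(δ ^ 2 * m)) * Real.exp (-δ * ∑ i ∈ U, boolSign (σ i))) := by
        gcongr with σ
        split_ifs with hσ
        · rw [← Real.exp_add, ← Real.exp_add]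
          rcases lt_abs.1 hσ with h' | h'
          · have := Real.one_le_exp (x := -(δ ^ 2 * m) + δ * ∑ i ∈ U, boolSign (σ i))
              (by nlinarith)
            have := Real.exp_pos (-(δ ^ 2 * m) + -δ * ∑ i ∈ U, boolSign (σ i))
            linarith
          · have := Real.one_le_exp (x := -(δ ^ 2 * m) + -δ * ∑ i ∈ U, boolSign (σ i))
              (by nlinarith)
            have := Real.exp_pos (-(δ ^ 2 * m) + δ * ∑ i ∈ U, boolSign (σ i))
            linarith
        · positivity
    _ ≤ _ := by
        rw [Finset.sum_add_distrib, ← Finset.mul_sum, ← Finset.mul_sum]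
        linarith [h δ rfl, h (-δ) (neg_sq δ)]

/-! ### The hidden functions -/

/-- The set function that hides the signs `σ` outside of the two blocks `P` and `Q`. -/
def hiddenFn {α : Type} [Fintype α] [DecidableEq α] (P Q : Finset α) (τ B : ℝ) (σ : α → ℝ)
    (S : Finset α) : ℝ :=
  ((S ∩ (P ∪ Q)ᶜ).card : ℝ) * ((P ∪ Q)ᶜ.card - (S ∩ (P ∪ Q)ᶜ).card) +
      truncSq τ (∑ i ∈ S ∩ (P ∪ Q)ᶜ, σ i) +
    B * ((S ∩ P).card + (S ∩ Q).card - (S ∩ P).card * (S ∩ Q).card)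

/-- Splitting along `S ∩ T`, `S \ T`, `T \ S` turns submodularity into an inequality for second
differences. -/
theorem sum_inter_eq_add {α : Type} [DecidableEq α] (S T E : Finset α) (w : α → ℝ) :
    ∑ i ∈ S ∩ E, w i = ∑ i ∈ S ∩ T ∩ E, w i + ∑ i ∈ (S \ T) ∩ E, w i := by
  rw [← Finset.sum_union]
  · congr 1
    ext x; simp; tauto
  · rw [Finset.disjoint_left]
    intro x; simp; tauto

theorem sum_union_inter_eq_add {α : Type} [DecidableEq α] (S T E : Finset α) (w : α → ℝ) :
    ∑ i ∈ (S ∪ T) ∩ E, w i =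
      ∑ i ∈ S ∩ T ∩ E, w i + ∑ i ∈ (S \ T) ∩ E, w i + ∑ i ∈ (T \ S) ∩ E, w i := by
  rw [← sum_inter_eq_add S T, sum_inter_eq_add (S ∪ T) S]
  congr 2 <;> ext x <;> grind

theorem card_inter_eq_add {α : Type} [DecidableEq α] (S T E : Finset α) :
    ((S ∩ E).card : ℝ) = (S ∩ T ∩ E).card + ((S \ T) ∩ E).card := by
  simpa using sum_inter_eq_add S T E fun _ => 1

theorem card_union_inter_eq_add {α : Type} [DecidableEq α] (S T E : Finset α) :
    (((S ∪ T) ∩ E).card : ℝ) =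
      (S ∩ T ∩ E).card + ((S \ T) ∩ E).card + ((T \ S) ∩ E).card := by
  simpa using sum_union_inter_eq_add S T E fun _ => 1

theorem abs_sum_le_card {α : Type} (U : Finset α) {σ : α → ℝ} (hσ : ∀ i, |σ i| ≤ 1) :
    |∑ i ∈ U, σ i| ≤ U.card := by
  refine (Finset.abs_sum_le_sum_abs _ _).trans ?_
  simpa using Finset.sum_le_sum fun i (_ : i ∈ U) => hσ i

/-- Zero weights are admitted because the function without signs must also be a legal instance: the
query bound is applied to it. Nonnegativity uses 2(p + q - pq) = p(2 - q) + q(2 - p). -/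
theorem isNonnegSubmodular_hiddenFn {α : Type} [Fintype α] [DecidableEq α] {P Q : Finset α}
    (hP : P.card = 2) (hQ : Q.card = 2) {τ B : ℝ} (hτ : 0 ≤ τ) (hB : 0 ≤ B) {σ : α → ℝ}
    (hσ : ∀ i, |σ i| ≤ 1) : IsNonnegSubmodular (hiddenFn P Q τ B σ) where
  nonneg S := by
    have h1 : ((S ∩ (P ∪ Q)ᶜ).card : ℝ) ≤ (P ∪ Q)ᶜ.card := by
      exact_mod_cast Finset.card_le_card Finset.inter_subset_right
    have h2 : ((S ∩ P).card : ℝ) ≤ 2 := by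
      exact_mod_cast hP ▸ Finset.card_le_card Finset.inter_subset_right
    have h3 : ((S ∩ Q).card : ℝ) ≤ 2 := by
      exact_mod_cast hQ ▸ Finset.card_le_card Finset.inter_subset_right
    have h4 : (0 : ℝ) ≤ (S ∩ P).card := Nat.cast_nonneg _
    have h5 : (0 : ℝ) ≤ (S ∩ Q).card := Nat.cast_nonneg _
    have h6 : (0 : ℝ) ≤ (S ∩ P).card + (S ∩ Q).card - (S ∩ P).card * (S ∩ Q).card := by
      nlinarith [mul_nonneg h4 (sub_nonneg.2 h3), mul_nonneg h5 (sub_nonneg.2 h2)]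
    exact add_nonneg (add_nonneg (mul_nonneg (Nat.cast_nonneg _) (sub_nonneg.2 h1))
      (truncSq_nonneg _ _)) (mul_nonneg hB h6)
  submodular S T := by
    have hd := truncSq_second_difference hτ (∑ i ∈ S ∩ T ∩ (P ∪ Q)ᶜ, σ i)
      (∑ i ∈ (S \ T) ∩ (P ∪ Q)ᶜ, σ i) (∑ i ∈ (T \ S) ∩ (P ∪ Q)ᶜ, σ i)
    have huv := mul_le_mul (abs_sum_le_card ((S \ T) ∩ (P ∪ Q)ᶜ) hσ)
      (abs_sum_le_card ((T \ S) ∩ (P ∪ Q)ᶜ) hσ) (abs_nonneg _) (Nat.cast_nonneg _)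
    -- This is the slack coming from -pq; the terms linear in p and q are modular.
    have hpq : 0 ≤ B * ((((S \ T) ∩ P).card : ℝ) * ((T \ S) ∩ Q).card +
        ((T \ S) ∩ P).card * ((S \ T) ∩ Q).card) := by positivity
    simp only [hiddenFn]
    rw [sum_union_inter_eq_add, sum_inter_eq_add S T, sum_inter_eq_add T S,
      card_inter_eq_add S T (P ∪ Q)ᶜ, card_inter_eq_add T S (P ∪ Q)ᶜ,
      card_inter_eq_add S T P, card_inter_eq_add T S P, card_inter_eq_add S T Q,
      card_inter_eq_add T S Q, card_union_inter_eq_add S T (P ∪ Q)ᶜ,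
      card_union_inter_eq_add S T P, card_union_inter_eq_add S T Q, Finset.inter_comm T S]
    linarith

/-- The hidden signs do not show on sets on which they are nearly balanced. -/
theorem hiddenFn_eq_of_abs_sum_le {α : Type} [Fintype α] [DecidableEq α] {P Q : Finset α}
    {τ B : ℝ} (hτ : 0 ≤ τ) {σ : α → ℝ} {S : Finset α}
    (h : |∑ i ∈ S ∩ (P ∪ Q)ᶜ, σ i| ≤ τ) :
    hiddenFn P Q τ B σ S = hiddenFn P Q τ B 0 S := by
  simp only [hiddenFn]
  rw [truncSq_of_abs_le h, truncSq_of_abs_le (by simpa using hτ)]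

/-- Sets that contain exactly one element of `P` have small balanced value. -/
theorem hiddenFn_zero_le_of_card_inter_eq_one {α : Type} [Fintype α] [DecidableEq α]
    {P Q : Finset α} {τ B : ℝ} (hτ : 0 ≤ τ) {S : Finset α} (h : (S ∩ P).card = 1) :
    hiddenFn P Q τ B 0 S ≤ ((P ∪ Q)ᶜ.card : ℝ) ^ 2 / 4 + B := by
  simp only [hiddenFn]
  rw [truncSq_of_abs_le (by simpa using hτ), h]
  have := sq_nonneg (((P ∪ Q)ᶜ.card : ℝ) - 2 * (S ∩ (P ∪ Q)ᶜ).card)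
  push_cast
  nlinarith

theorem hiddenFn_left {α : Type} [Fintype α] [DecidableEq α] {P Q : Finset α}
    (hP : P.card = 2) (hPQ : Disjoint P Q) {τ B : ℝ} (hτ : 0 ≤ τ) (σ : α → ℝ) :
    hiddenFn P Q τ B σ P = 2 * B := by
  have h : P ∩ (P ∪ Q)ᶜ = ∅ := by ext; simp; tauto
  simp only [hiddenFn]
  rw [h, Finset.inter_self, hP, Finset.disjoint_iff_inter_eq_empty.1 hPQ]
  simp [truncSq_of_abs_le, hτ, mul_comm]

theorem hiddenFn_comm {α : Type} [Fintype α] [DecidableEq α] (P Q : Finset α) (τ B : ℝ)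
    (σ : α → ℝ) : hiddenFn P Q τ B σ = hiddenFn Q P τ B σ := by
  ext S
  simp only [hiddenFn]
  rw [Finset.union_comm]
  ring

/-! ### Reconfiguration sequences -/

theorem ReconfSeq.value_le {α : Type} [DecidableEq α] {X Y : Finset α} (f : Finset α → ℝ)
    (S : ReconfSeq X Y) (i : Fin (S.1.length + 1)) : S.value f ≤ f (S.1 i) :=
  Finset.inf'_le _ (Finset.mem_univ i)

theorem ReconfSeq.value_le_left {α : Type} [DecidableEq α] {X Y : Finset α} (f : Finset α → ℝ)
    (S : ReconfSeq X Y) : S.value f ≤ f X := by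
  have h := S.value_le f 0
  rwa [show S.1 0 = X from S.2.1] at h

theorem TJ.symm {α : Type} [DecidableEq α] {S T : Finset α} (h : TJ S T) : TJ T S :=
  ⟨h.1.symm, by rw [Finset.inter_comm, h.2, h.1]⟩

theorem TAR.symm {α : Type} [DecidableEq α] {S T : Finset α} (h : TAR S T) : TAR T S := by
  rwa [TAR, symmDiff_comm]

theorem mem_tjar_symm {α : Type} [DecidableEq α] {S T : Finset α} (h : (S, T) ∈ tjar α) :
    (T, S) ∈ tjar α :=
  Or.imp TJ.symm TAR.symm h

theorem card_sdiff_le_one_of_mem_tjar {α : Type} [DecidableEq α] {S T : Finset α}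
    (h : (S, T) ∈ tjar α) : (S \ T).card ≤ 1 := by
  rcases h with ⟨-, h⟩ | h
  · have := Finset.card_sdiff_add_card_inter S T
    simp only at h
    omega
  · exact (Finset.card_le_card le_sup_left).trans h.le

theorem card_inter_le_of_mem_tjar {α : Type} [DecidableEq α] {S T : Finset α}
    (h : (S, T) ∈ tjar α) (P : Finset α) : (S ∩ P).card ≤ (T ∩ P).card + 1 := by
  have h1 : S ∩ P ⊆ (T ∩ P) ∪ (S \ T) := by intro x; simp; tauto
  have := (Finset.card_le_card h1).trans (Finset.card_union_le _ _)
  have := card_sdiff_le_one_of_mem_tjar h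
  omega

/-- A reconfiguration sequence from a set with two elements in `P` to a set without elements in
`P` passes through a set with one element in `P`. -/
theorem ReconfSeq.exists_card_inter_eq_one {α : Type} [DecidableEq α] {X Y P : Finset α}
    (S : ReconfSeq X Y) (hX : 1 < (X ∩ P).card) (hY : Y ∩ P = ∅) :
    ∃ i, (S.1 i ∩ P).card = 1 := by
  by_contra! hne
  have h : ∀ i : Fin (S.1.length + 1), 1 < (S.1 i ∩ P).card := by
    intro i
    induction i using Fin.induction with
    | zero => rwa [show S.1 0 = X from S.2.1]
    | succ i ih =>
      have h1 := card_inter_le_of_mem_tjar (S.1.step i) P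
      have h2 := hne i.succ
      have h3 : 1 < (S.1 i.castSucc ∩ P).card := ih
      omega
  have hl := h (Fin.last _)
  rw [show S.1 (Fin.last _) = Y from S.2.2, hY] at hl
  simp at hl

/-- Adjacency between sets on which `f` is at least `c`. -/
def StepAbove {α : Type} [DecidableEq α] (f : Finset α → ℝ) (c : ℝ) (S T : Finset α) : Prop :=
  (S, T) ∈ tjar α ∧ c ≤ f S ∧ c ≤ f T

theorem StepAbove.reflTransGen_symm {α : Type} [DecidableEq α] {f : Finset α → ℝ} {c : ℝ}
    {X Y : Finset α} (h : Relation.ReflTransGen (StepAbove f c) X Y) :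
    Relation.ReflTransGen (StepAbove f c) Y X := by
  induction h with
  | refl => exact .refl
  | tail _ h ih => exact ih.head ⟨mem_tjar_symm h.1, h.2.2, h.2.1⟩

theorem le_optValue_of_reflTransGen {α : Type} [DecidableEq α] [Finite α] {f : Finset α → ℝ}
    {c : ℝ} {X Y : Finset α} (hX : c ≤ f X) (h : Relation.ReflTransGen (StepAbove f c) X Y) :
    c ≤ optValue f X Y := by
  obtain ⟨S, h0, h1, hS⟩ : ∃ S : RelSeries (tjar α), S.head = X ∧ S.last = Y ∧ ∀ i, c ≤ f (S i) := by
    induction h with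
    | refl => exact ⟨RelSeries.singleton _ X, rfl, rfl, fun _ => hX⟩
    | @tail Y Z _ hYZ ih =>
      obtain ⟨S, h0, h1, hS⟩ := ih
      refine ⟨S.snoc Z (h1 ▸ hYZ.1), by rw [RelSeries.head_snoc, h0], by rw [RelSeries.last_snoc],
        fun i => ?_⟩
      have hi : S.snoc Z (h1 ▸ hYZ.1) i ∈ S.snoc Z (h1 ▸ hYZ.1) := ⟨i, rfl⟩
      rw [RelSeries.mem_snoc] at hi
      rcases hi with ⟨j, hj⟩ | hi
      · rw [← hj]; exact hS j
      · rw [hi]; exact hYZ.2.2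
  refine le_trans ?_ ((optValue_isGreatest f X Y).2 ⟨⟨S, h0, h1⟩, rfl⟩)
  exact Finset.le_inf' _ _ fun i _ => hS i

theorem reflTransGen_union {α : Type} [DecidableEq α] {f : Finset α → ℝ} {c : ℝ}
    {X K : Finset α} (hf : ∀ L ⊆ K, c ≤ f (X ∪ L)) :
    Relation.ReflTransGen (StepAbove f c) X (X ∪ K) := by
  induction K using Finset.induction_on with
  | empty => rw [Finset.union_empty]
  | insert a K ha ih =>
    refine (ih fun L hL => hf L (hL.trans (Finset.subset_insert _ _))).trans ?_
    by_cases haX : a ∈ X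
    · rw [Finset.union_insert, Finset.insert_eq_of_mem (by simp [haX])]
    · refine .single ⟨Or.inr ?_, hf _ (Finset.subset_insert _ _), hf _ subset_rfl⟩
      rw [Finset.union_insert]
      exact TAR.insert_right (by simp [haX, ha])

theorem insert_insert_mem_tjar {α : Type} [DecidableEq α] {a b : α} {S : Finset α} (ha : a ∉ S)
    (hb : b ∉ S) (hab : a ≠ b) : (insert a S, insert b S) ∈ tjar α := by
  refine Or.inl ⟨by simp [ha, hb], ?_⟩
  have : insert a S ∩ insert b S = S := by
    ext x; simp only [Finset.mem_inter, Finset.mem_insert]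
    constructor
    · rintro ⟨rfl | h, rfl | h'⟩ <;> first | assumption | exact absurd rfl hab
    · exact fun h => ⟨Or.inr h, Or.inr h⟩
  simp [this, ha]

theorem le_hiddenFn_left_union {α : Type} [Fintype α] [DecidableEq α] {P Q L : Finset α}
    (hP : P.card = 2) (hPQ : Disjoint P Q) (hL : L ⊆ (P ∪ Q)ᶜ) (τ B : ℝ) (σ : α → ℝ) :
    2 * B ≤ hiddenFn P Q τ B σ (P ∪ L) := by
  have h1 : (P ∪ L) ∩ P = P := by ext; simp
  have h2 : (P ∪ L) ∩ Q = ∅ := by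
    ext x
    have h1 : x ∈ L → x ∉ P ∧ x ∉ Q := fun hx => by simpa using hL hx
    have h2 : x ∈ P → x ∉ Q := fun hx => Finset.disjoint_left.1 hPQ hx
    simp; tauto
  have h3 : (((P ∪ L) ∩ (P ∪ Q)ᶜ).card : ℝ) ≤ (P ∪ Q)ᶜ.card := by
    exact_mod_cast Finset.card_le_card Finset.inter_subset_right
  simp only [hiddenFn]
  rw [h1, h2, hP]
  have := mul_nonneg (Nat.cast_nonneg (α := ℝ) ((P ∪ L) ∩ (P ∪ Q)ᶜ).card) (sub_nonneg.2 h3)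
  have := truncSq_nonneg τ (∑ i ∈ (P ∪ L) ∩ (P ∪ Q)ᶜ, σ i)
  push_cast [Finset.card_empty]
  linarith

theorem hiddenFn_insert_insert {α : Type} [Fintype α] [DecidableEq α] {P Q K : Finset α} {a b : α}
    (hPQ : Disjoint P Q) (ha : a ∈ P) (hb : b ∈ Q) (hK : K ⊆ (P ∪ Q)ᶜ) (τ B : ℝ) (σ : α → ℝ) :
    hiddenFn P Q τ B σ (insert a (insert b K)) =
      K.card * ((P ∪ Q)ᶜ.card - K.card) + truncSq τ (∑ i ∈ K, σ i) + B := by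
  have hdis : ∀ x, ¬ (x ∈ P ∧ x ∈ Q) := fun x h => Finset.disjoint_left.1 hPQ h.1 h.2
  have hK' : ∀ x ∈ K, x ∉ P ∧ x ∉ Q := fun x hx => by simpa using hK hx
  have h1 : insert a (insert b K) ∩ P = {a} := by
    ext x; have := hdis x; have := hK' x
    simp only [Finset.mem_inter, Finset.mem_insert, Finset.mem_singleton]
    grind
  have h2 : insert a (insert b K) ∩ Q = {b} := by
    ext x; have := hdis x; have := hK' x
    simp only [Finset.mem_inter, Finset.mem_insert, Finset.mem_singleton]
    grind
  have h3 : insert a (insert b K) ∩ (P ∪ Q)ᶜ = K := by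
    ext x; have := hK' x
    simp only [Finset.mem_inter, Finset.mem_insert, Finset.mem_compl, Finset.mem_union]
    grind
  simp only [hiddenFn]
  rw [h1, h2, h3, Finset.card_singleton, Finset.card_singleton]
  push_cast
  ring

/-- If the signs hide a set `K` of large value, then one can change over from `P` to `Q` on top of
`K`. -/
theorem two_mul_le_optValue_hiddenFn {α : Type} [Fintype α] [DecidableEq α] {P Q K : Finset α}
    (hP : P.card = 2) (hQ : Q.card = 2) (hPQ : Disjoint P Q) (hK : K ⊆ (P ∪ Q)ᶜ) {τ B : ℝ}
    {σ : α → ℝ}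
    (hB : B ≤ K.card * ((P ∪ Q)ᶜ.card - K.card) + truncSq τ (∑ i ∈ K, σ i)) :
    2 * B ≤ optValue (hiddenFn P Q τ B σ) P Q := by
  have hl : ∀ L ⊆ K, 2 * B ≤ hiddenFn P Q τ B σ (P ∪ L) := fun L hL =>
    le_hiddenFn_left_union hP hPQ (hL.trans hK) τ B σ
  have hr : ∀ L ⊆ K, 2 * B ≤ hiddenFn P Q τ B σ (Q ∪ L) := fun L hL => by
    rw [hiddenFn_comm]
    exact le_hiddenFn_left_union hQ hPQ.symm (by rw [Finset.union_comm]; exact hL.trans hK) τ B σ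
  refine le_optValue_of_reflTransGen (by simpa using hl ∅ (Finset.empty_subset _)) ?_
  refine (reflTransGen_union hl).trans
    (Relation.ReflTransGen.trans ?_ (StepAbove.reflTransGen_symm (reflTransGen_union hr)))
  have hlK := hl K subset_rfl
  have hrK := hr K subset_rfl
  obtain ⟨a, b, hab, rfl⟩ := Finset.card_eq_two.1 hP
  obtain ⟨c, d, hcd, rfl⟩ := Finset.card_eq_two.1 hQ
  have hm := hiddenFn_insert_insert (a := a) (b := c) hPQ (by simp) (by simp) hK τ B σ
  have hK' : ∀ x ∈ K, x ≠ a ∧ x ≠ b ∧ x ≠ c ∧ x ≠ d := fun x hx => by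
    have := hK hx
    simp at this; tauto
  have hne : a ≠ c ∧ a ≠ d ∧ b ≠ c ∧ b ≠ d := by
    simp at hPQ; tauto
  have e1 : ({a, b} ∪ K : Finset α) = insert b (insert a K) := by ext; simp; tauto
  have e2 : ({c, d} ∪ K : Finset α) = insert d (insert c K) := by ext; simp; tauto
  rw [e1] at hlK ⊢
  rw [e2] at hrK ⊢
  -- Two token jumps cross over, and this is the only set between them. Its blocks give only one
  -- `B`; the other comes from `K` through `hB`.
  have hmid : 2 * B ≤ hiddenFn {a, b} {c, d} τ B σ (insert a (insert c K)) := by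
    rw [hm]; linarith
  refine Relation.ReflTransGen.trans (.single (b := insert a (insert c K)) ⟨?_, hlK, hmid⟩)
    (.single ⟨?_, hmid, hrK⟩)
  · rw [Finset.insert_comm a c]
    exact insert_insert_mem_tjar (by grind) (by grind) hne.2.2.1
  · exact insert_insert_mem_tjar (by grind) (by grind) hne.2.1

/-- Random signs always hide a set of large value. -/
theorem two_mul_le_optValue_hiddenFn_boolSign {α : Type} [Fintype α] [DecidableEq α]
    {P Q : Finset α} (hP : P.card = 2) (hQ : Q.card = 2) (hPQ : Disjoint P Q) {δ : ℝ}
    (hδ : 0 ≤ δ) (hδ' : δ ≤ 1 / 2) (σ : α → Bool) {B : ℝ}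
    (hB : B = (1 / 2 - δ) * ((P ∪ Q)ᶜ.card : ℝ) ^ 2) :
    2 * B ≤ optValue (hiddenFn P Q (δ * (P ∪ Q)ᶜ.card) B fun i => boolSign (σ i)) P Q := by
  -- `K` is the larger of the two sign classes.
  obtain ⟨K, hK, hk, hs⟩ : ∃ K ⊆ (P ∪ Q)ᶜ, ((P ∪ Q)ᶜ.card : ℝ) / 2 ≤ K.card ∧
      |∑ i ∈ K, boolSign (σ i)| = K.card := by
    have h := Finset.card_filter_add_card_filter_not (s := (P ∪ Q)ᶜ) (fun i => σ i = true)
    have h' : (((P ∪ Q)ᶜ.filter fun i => σ i = true).card : ℝ) +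
        ((P ∪ Q)ᶜ.filter fun i => ¬ σ i = true).card = (P ∪ Q)ᶜ.card := by exact_mod_cast h
    rcases le_total (((P ∪ Q)ᶜ.card : ℝ) / 2) ((P ∪ Q)ᶜ.filter fun i => σ i = true).card with h1 | h1
    · refine ⟨_, Finset.filter_subset _ _, h1, ?_⟩
      rw [Finset.sum_congr rfl (g := fun _ => (1 : ℝ))
        fun i hi => by simp [boolSign, (Finset.mem_filter.1 hi).2]]
      simp
    · refine ⟨(P ∪ Q)ᶜ.filter fun i => ¬ σ i = true, Finset.filter_subset _ _, by linarith, ?_⟩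
      rw [Finset.sum_congr rfl (g := fun _ => (-1 : ℝ))
        fun i hi => by simp [boolSign, (Finset.mem_filter.1 hi).2]]
      simp
  refine two_mul_le_optValue_hiddenFn hP hQ hPQ hK ?_
  have hm : (0 : ℝ) ≤ (P ∪ Q)ᶜ.card := Nat.cast_nonneg _
  -- With k = |K| ≥ m/2, k(m - k) + (k - δm)² = (1 - 2δ)km + δ²m² ≥ (1/2 - δ)m².
  rw [truncSq_of_le_abs (by positivity) (by rw [hs]; nlinarith), hs, hB]
  nlinarith [mul_nonneg (mul_nonneg (sub_nonneg.2 hδ') hm) (sub_nonneg.2 hk),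
    sq_nonneg (δ * ((P ∪ Q)ᶜ.card : ℝ))]

/-! ### Oracle computations -/

/-- The queries of a computation when the oracle answers according to `f`. -/
def OracleComp.queries {Q β : Type} (f : Q → ℝ) : OracleComp Q β → List Q
  | .output _ => []
  | .query q next => q :: (next (f q)).queries f

theorem OracleComp.length_queries {Q β : Type} (f : Q → ℝ) (A : OracleComp Q β) :
    (A.queries f).length = A.calls f := by
  induction A with
  | output b => rfl
  | query q next ih => simp [queries, calls, ih]

theorem OracleComp.run_congr {Q β : Type} {f g : Q → ℝ} (A : OracleComp Q β)
    (h : ∀ q ∈ A.queries f, g q = f q) : A.run g = A.run f := by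
  induction A with
  | output b => rfl
  | query q next ih =>
    rw [queries] at h
    rw [run, run, h q List.mem_cons_self]
    exact ih _ fun r hr => h r (List.mem_cons_of_mem _ hr)

/-! ### The query lower bound -/

theorem sum_value_run_hiddenFn_le {α : Type} [Fintype α] [DecidableEq α] {P Q : Finset α}
    (hP : P.card = 2) (hPQ : Disjoint P Q) {δ B q : ℝ} (hδ : 0 ≤ δ) (hB : 0 ≤ B)
    (A : OracleComp (Finset α) (ReconfSeq P Q))
    (hA : (A.calls (hiddenFn P Q (δ * (P ∪ Q)ᶜ.card) B 0) : ℝ) ≤ q) :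
    ∑ σ : α → Bool,
        (A.run (hiddenFn P Q (δ * (P ∪ Q)ᶜ.card) B fun i => boolSign (σ i))).value
          (hiddenFn P Q (δ * (P ∪ Q)ᶜ.card) B fun i => boolSign (σ i)) ≤
      2 ^ Fintype.card α * (((P ∪ Q)ᶜ.card : ℝ) ^ 2 / 4 + B +
        4 * B * ((q + 1) * Real.exp (-(δ ^ 2 * (P ∪ Q)ᶜ.card / 2)))) := by
  obtain ⟨m, hm⟩ : ∃ m : ℝ, m = (P ∪ Q)ᶜ.card := ⟨_, rfl⟩
  rw [← hm] at hA ⊢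
  have hm0 : 0 ≤ m := hm ▸ Nat.cast_nonneg _
  have hτ : 0 ≤ δ * m := mul_nonneg hδ hm0
  -- The run without signs fixes its queries and its output independently of `σ`. One output set
  -- with a single element in `P` joins the queries in `T`, whence `q + 1`.
  obtain ⟨i, hi⟩ := (A.run (hiddenFn P Q (δ * m) B 0)).exists_card_inter_eq_one (P := P)
    (by rw [Finset.inter_self, hP]; exact one_lt_two)
    (by rw [Finset.inter_comm, Finset.disjoint_iff_inter_eq_empty.1 hPQ])
  obtain ⟨T, hT⟩ : ∃ T, T = insert ((A.run (hiddenFn P Q (δ * m) B 0)).1 i)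
    (A.queries (hiddenFn P Q (δ * m) B 0)).toFinset := ⟨_, rfl⟩
  have hTq : (T.card : ℝ) ≤ q + 1 := by
    have h1 : T.card ≤ A.calls (hiddenFn P Q (δ * m) B 0) + 1 := by
      rw [hT, ← OracleComp.length_queries]
      exact (Finset.card_insert_le _ _).trans (Nat.succ_le_succ (List.toFinset_card_le _))
    have h2 : (T.card : ℝ) ≤ A.calls (hiddenFn P Q (δ * m) B 0) + 1 := by exact_mod_cast h1
    linarith
  have hσ : ∀ σ : α → Bool,
      (A.run (hiddenFn P Q (δ * m) B fun i => boolSign (σ i))).value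
          (hiddenFn P Q (δ * m) B fun i => boolSign (σ i)) ≤
        m ^ 2 / 4 + B + 2 * B * ∑ U ∈ T,
          if δ * m < |∑ i ∈ U ∩ (P ∪ Q)ᶜ, boolSign (σ i)| then (1 : ℝ) else 0 := by
    intro σ
    by_cases h : ∃ U ∈ T, δ * m < |∑ i ∈ U ∩ (P ∪ Q)ᶜ, boolSign (σ i)|
    · obtain ⟨U, hU, hU'⟩ := h
      -- If the signs show on some set of `T`, the trivial bound by the value `2 * B` of the
      -- starting set suffices.
      have h1 := ReconfSeq.value_le_left (hiddenFn P Q (δ * m) B fun i => boolSign (σ i))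
        (A.run (hiddenFn P Q (δ * m) B fun i => boolSign (σ i)))
      rw [hiddenFn_left hP hPQ hτ] at h1
      have h2 := Finset.single_le_sum (f := fun U =>
        if δ * m < |∑ i ∈ U ∩ (P ∪ Q)ᶜ, boolSign (σ i)| then (1 : ℝ) else 0)
        (fun U _ => by split_ifs <;> norm_num) hU
      simp only [if_pos hU'] at h2
      nlinarith [sq_nonneg m]
    · push Not at h
      have heq : ∀ U ∈ T, hiddenFn P Q (δ * m) B (fun i => boolSign (σ i)) U =
          hiddenFn P Q (δ * m) B 0 U := fun U hU => hiddenFn_eq_of_abs_sum_le hτ (h U hU)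
      have hrun : A.run (hiddenFn P Q (δ * m) B fun i => boolSign (σ i)) =
          A.run (hiddenFn P Q (δ * m) B 0) :=
        A.run_congr fun U hU => heq U (by rw [hT]; simp [hU])
      have h1 := ReconfSeq.value_le (hiddenFn P Q (δ * m) B fun i => boolSign (σ i))
        (A.run (hiddenFn P Q (δ * m) B 0)) i
      rw [heq _ (by rw [hT]; simp)] at h1
      have h2 := hiddenFn_zero_le_of_card_inter_eq_one (Q := Q) (B := B) hτ hi
      rw [← hm] at h2
      rw [hrun, Finset.sum_congr rfl fun U hU => if_neg (h U hU).not_gt]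
      simp only [Finset.sum_const_zero, mul_zero, add_zero]
      exact h1.trans h2
  have hbad : ∀ U ∈ T, (∑ σ : α → Bool,
      if δ * m < |∑ i ∈ U ∩ (P ∪ Q)ᶜ, boolSign (σ i)| then (1 : ℝ) else 0) ≤
        2 ^ Fintype.card α * (2 * Real.exp (-(δ ^ 2 * m / 2))) := by
    intro U _
    rw [Finset.sum_boole]
    refine card_filter_lt_abs_sum_boolSign_le _ hδ ?_
    rw [hm]
    exact_mod_cast Finset.card_le_card Finset.inter_subset_right
  calc _ ≤ ∑ σ : α → Bool, (m ^ 2 / 4 + B + 2 * B * ∑ U ∈ T,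
          if δ * m < |∑ i ∈ U ∩ (P ∪ Q)ᶜ, boolSign (σ i)| then (1 : ℝ) else 0) :=
        Finset.sum_le_sum fun σ _ => hσ σ
    _ = 2 ^ Fintype.card α * (m ^ 2 / 4 + B) + 2 * B * ∑ U ∈ T, ∑ σ : α → Bool,
          if δ * m < |∑ i ∈ U ∩ (P ∪ Q)ᶜ, boolSign (σ i)| then (1 : ℝ) else 0 := by
        rw [Finset.sum_add_distrib, ← Finset.mul_sum, Finset.sum_comm]
        simp [mul_add]
    _ ≤ 2 ^ Fintype.card α * (m ^ 2 / 4 + B) +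
          2 * B * (T.card * (2 ^ Fintype.card α * (2 * Real.exp (-(δ ^ 2 * m / 2))))) := by
        gcongr
        rw [← nsmul_eq_mul]
        exact Finset.sum_le_card_nsmul _ _ _ hbad
    _ ≤ 2 ^ Fintype.card α * (m ^ 2 / 4 + B) +
          2 * B * ((q + 1) * (2 ^ Fintype.card α * (2 * Real.exp (-(δ ^ 2 * m / 2))))) := by
        gcongr
    _ = _ := by ring

/-- The approximation ratio of an algorithm with few oracle calls, in expectation. -/
theorem IsApproxInExpectation.mul_optimum_le {n : ℕ} (hn : 4 ≤ n) {Ω : Type*} [MeasurableSpace Ω]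
    {P : Measure Ω} [IsProbabilityMeasure P] {A : Ω → RecoAlgorithm n} {ρ q δ : ℝ} (hδ : 0 ≤ δ)
    (hδ' : δ ≤ 1 / 2) (hρ : 0 ≤ ρ) (hq : ∀ ω, (A ω).MakesAtMost q)
    (hA : IsApproxInExpectation P A ρ) {B : ℝ} (hB : B = (1 / 2 - δ) * ((n : ℝ) - 4) ^ 2) :
    ρ * (2 * B) ≤ ((n : ℝ) - 4) ^ 2 / 4 + B +
      4 * B * ((q + 1) * Real.exp (-(δ ^ 2 * ((n : ℝ) - 4) / 2))) := by
  obtain ⟨X, Y, hX, hY, hXY⟩ : ∃ X Y : Finset (Fin n), X.card = 2 ∧ Y.card = 2 ∧ Disjoint X Y := by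
    obtain ⟨Z, -, hZ⟩ := Finset.exists_subset_card_eq (s := (Finset.univ : Finset (Fin n))) (n := 4)
      (by simpa using hn)
    obtain ⟨X, hXZ, hX⟩ := Finset.exists_subset_card_eq (s := Z) (n := 2) (by omega)
    refine ⟨X, Z \ X, hX, ?_, Finset.disjoint_sdiff⟩
    rw [Finset.card_sdiff_of_subset hXZ]
    omega
  have hR : (((X ∪ Y)ᶜ.card : ℕ) : ℝ) = (n : ℝ) - 4 := by
    rw [Finset.card_compl, Fintype.card_fin, Finset.card_union_of_disjoint hXY, hX, hY,
      Nat.cast_sub hn]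
    norm_num
  rw [← hR] at hB ⊢
  have hB0 : 0 ≤ B := hB ▸ mul_nonneg (by linarith) (sq_nonneg _)
  have hτ : 0 ≤ δ * (X ∪ Y)ᶜ.card := by positivity
  have hsub : ∀ σ : Fin n → Bool, IsNonnegSubmodular
      (hiddenFn X Y (δ * (X ∪ Y)ᶜ.card) B fun i => boolSign (σ i)) := fun σ =>
    isNonnegSubmodular_hiddenFn hX hY hτ hB0 fun i => (abs_boolSign _).le
  have hlow : ∀ σ : Fin n → Bool, ρ * (2 * B) ≤
      ∫ ω, ((A ω X Y).run (hiddenFn X Y (δ * (X ∪ Y)ᶜ.card) B fun i => boolSign (σ i))).value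
        (hiddenFn X Y (δ * (X ∪ Y)ᶜ.card) B fun i => boolSign (σ i)) ∂P := fun σ =>
    (mul_le_mul_of_nonneg_left
      (two_mul_le_optValue_hiddenFn_boolSign hX hY hXY hδ hδ' σ hB) hρ).trans
      (hA _ (hsub σ) X Y).2
  -- Yao's principle: sum over all signs, exchange sum and integral, and apply the deterministic
  -- bound for each `ω`.
  have hsum := Finset.sum_le_sum fun σ (_ : σ ∈ Finset.univ) => hlow σ
  rw [← integral_finsetSum _ fun σ _ => (hA _ (hsub σ) X Y).1] at hsum
  have hup := integral_mono (μ := P)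
    (integrable_finsetSum _ fun σ _ => (hA _ (hsub σ) X Y).1) (integrable_const _)
    fun ω => sum_value_run_hiddenFn_le hX hXY hδ hB0 (A ω X Y)
      (hq ω _ (isNonnegSubmodular_hiddenFn hX hY hτ hB0 (by simp)) X Y)
  have h := hsum.trans hup
  rw [integral_const, probReal_univ, one_smul, Finset.sum_const, Finset.card_univ,
    Fintype.card_fun, Fintype.card_bool, nsmul_eq_mul] at h
  push_cast at h
  exact le_of_mul_le_mul_left h (by positivity)

/-- No algorithm has an approximation ratio greater than one. -/
theorem IsApproxInExpectation.le_one {n : ℕ} {Ω : Type*} [MeasurableSpace Ω] {P : Measure Ω}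
    [IsProbabilityMeasure P] {A : Ω → RecoAlgorithm n} {ρ : ℝ}
    (hA : IsApproxInExpectation P A ρ) : ρ ≤ 1 := by
  have hv : ∀ S : ReconfSeq (∅ : Finset (Fin n)) ∅, S.value (fun _ => 1) = 1 := fun S =>
    Finset.inf'_const _ _
  have h := (hA (fun _ => 1) ⟨fun _ => zero_le_one, fun _ _ => le_rfl⟩ ∅ ∅).2
  obtain ⟨S, hS⟩ := (optValue_isGreatest (fun _ : Finset (Fin n) => (1 : ℝ)) ∅ ∅).1
  rw [← hS, hv S] at h
  simpa [hv] using h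

theorem RecoAlgorithm.IsApprox.isApproxInExpectation {n : ℕ} {A : RecoAlgorithm n} {ρ : ℝ}
    (hA : A.IsApprox ρ) :
    IsApproxInExpectation (Measure.dirac ()) (fun _ => A) ρ := fun f hf X Y =>
  ⟨integrable_const _, by simpa using hA f hf X Y⟩

/-- Since δ = 5ε/4 exceeds ε, the Hoeffding exponent wins by (25/16 - 1)ε²n/2 = 9ε²n/32; replacing n
by n - 4 costs only the constant factor exp(25ε²/8). -/
theorem tendsto_query_bound_mul_exp {ε : ℝ} (hε : 0 < ε) :
    Tendsto (fun n : ℕ => (Real.exp (ε ^ 2 * n / 2) + 1) *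
      Real.exp (-((5 / 4 * ε) ^ 2 * ((n : ℝ) - 4) / 2))) atTop (nhds 0) := by
  have h1 : Tendsto (fun n : ℕ => (9 / 32 * ε ^ 2) * (n : ℝ)) atTop atTop :=
    tendsto_natCast_atTop_atTop.const_mul_atTop (by positivity)
  have h2 : Tendsto (fun n : ℕ => (25 / 32 * ε ^ 2) * (n : ℝ)) atTop atTop :=
    tendsto_natCast_atTop_atTop.const_mul_atTop (by positivity)
  have h := ((Real.tendsto_exp_neg_atTop_nhds_zero.comp h1).add
    (Real.tendsto_exp_neg_atTop_nhds_zero.comp h2)).const_mul (Real.exp (25 / 8 * ε ^ 2))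
  rw [add_zero, mul_zero] at h
  refine h.congr fun n => ?_
  simp only [Function.comp]
  rw [mul_add, add_mul, one_mul, ← Real.exp_add, ← Real.exp_add, ← Real.exp_add]
  congr 2 <;> ring

theorem exists_forall_not_isApproxInExpectation {ε : ℝ} (hε : 0 < ε) :
    ∃ N : ℕ, ∀ n : ℕ, N ≤ n → ∀ {Ω : Type*} [MeasurableSpace Ω] (P : Measure Ω)
      [IsProbabilityMeasure P] (A : Ω → RecoAlgorithm n),
      (∀ ω, (A ω).MakesAtMost (Real.exp (ε ^ 2 * n / 2))) →
        ¬ IsApproxInExpectation P A (5 / 6 + ε) := by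
  rcases lt_or_ge (1 / 6) ε with h6 | h6
  · exact ⟨0, fun n _ _ _ P _ A _ hA => by linarith [hA.le_one]⟩
  -- After division by (n - 4)², the main terms leave a gap 1/12 + ε/6 - 5ε²/2. With the threshold
  -- 1/48 the error is at most (1/2 - 5ε/4)/12, which is smaller for 0 < ε ≤ 1/6.
  obtain ⟨N, hN⟩ := eventually_atTop.1
    ((tendsto_query_bound_mul_exp hε).eventually_lt_const (show (0 : ℝ) < 1 / 48 by norm_num))
  refine ⟨max N 5, fun n hn _ _ P _ A hq hA => ?_⟩
  have hη := hN n (le_of_max_le_left hn)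
  have hn5 : 5 ≤ n := le_of_max_le_right hn
  have h := hA.mul_optimum_le (δ := 5 / 4 * ε) (by omega) (by linarith) (by linarith)
    (by linarith) hq rfl
  have hn5' : (5 : ℝ) ≤ n := by exact_mod_cast hn5
  generalize (Real.exp (ε ^ 2 * n / 2) + 1) *
    Real.exp (-((5 / 4 * ε) ^ 2 * ((n : ℝ) - 4) / 2)) = η at hη h
  obtain ⟨M, hM⟩ : ∃ M : ℝ, M = ((n : ℝ) - 4) ^ 2 := ⟨_, rfl⟩
  rw [← hM] at h
  have hM0 : 0 < M := by rw [hM]; exact pow_pos (by linarith) 2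
  have h' : M * ((5 / 6 + ε) * (2 * (1 / 2 - 5 / 4 * ε))) ≤
      M * (1 / 4 + (1 / 2 - 5 / 4 * ε) + 4 * (1 / 2 - 5 / 4 * ε) * η) := by linarith
  have h'' := le_of_mul_le_mul_left h' hM0
  have hb : (1 / 2 - 5 / 4 * ε) * η ≤ (1 / 2 - 5 / 4 * ε) * (1 / 48) :=
    mul_le_mul_of_nonneg_left hη.le (by linarith)
  nlinarith

end

theorem mainTheorem7 (ε : ℝ) (hε : 0 < ε) :
    ∃ N : ℕ, ∀ n : ℕ, N ≤ n →
      (¬ ∃ A : RecoAlgorithm n,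
        A.MakesAtMost (Real.exp (ε ^ 2 * n / 2)) ∧ A.IsApprox (5 / 6 + ε)) ∧
      (∀ (Ω : Type*) [MeasurableSpace Ω] (P : Measure Ω) [IsProbabilityMeasure P],
        ¬ ∃ A : Ω → RecoAlgorithm n,
          (∀ ω, (A ω).MakesAtMost (Real.exp (ε ^ 2 * n / 2))) ∧
            IsApproxInExpectation P A (5 / 6 + ε)) := by
  -- Two instances in different universes: one for the Dirac measure on `Unit`, the other for the
  -- given `Ω`.
  obtain ⟨N₁, h₁⟩ := exists_forall_not_isApproxInExpectation hε
  obtain ⟨N₂, h₂⟩ := exists_forall_not_isApproxInExpectation hε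
  refine ⟨max N₁ N₂, fun n hn => ⟨?_, fun Ω _ P _ => ?_⟩⟩
  · rintro ⟨A, hq, hA⟩
    exact h₁ n (le_of_max_le_left hn) (Measure.dirac ()) (fun _ => A) (fun _ => hq)
      hA.isApproxInExpectation
  · rintro ⟨A, hq, hA⟩
    exact h₂ n (le_of_max_le_right hn) P A hq hA
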